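/- Let $p=(p_1,p_2,p_3)$ be a homogeneous quadratic polynomial vector field on $\mathbb C^3$. Given $\gamma=(\gamma_{ij})\in\mathbb C^{3\times 3}$, call $p$ *distinguished with parameters $\gamma$* if the standard basis vectors $e_1,e_2,e_3$ and the three vectors $v_i=\gamma_{i1}e_1+\gamma_{i2}e_2+\gamma_{i3}e_3$ ($1\le i\le 3$) are idempotents of $p$ (i.e. nonzero solutions of $p(v)=v$), and the matrix with rows $(\gamma_{i1}\gamma_{i2},\ \gamma_{i2}\gamma_{i3},\ \gamma_{i3}\gamma_{i1})$, $1\le i\le 3$, is invertible. A nonconstant polynomial $\psi$ is a *semi-invariant* of a polynomial vector field $f$ on $\mathbb C^n$ if $\sum_i f_i\,\partial\psi/\partial x_i=\mu\psi$ for some polynomial $\mu$; its zero set is then an invariant algebraic hypersurface of $\dot x=f(x)$. For a polynomial vector field $f=f^{(0)}+\cdots+f^{(m)}$ on $\mathbb C^n$ ($f^{(j)}$ homogeneous of degree $j$, $f^{(m)}\ne0$) put $g_i(x_1,\dots,x_{n+1})=\sum_{j=0}^m f_i^{(j)}(x_1,\dots,x_n)\,x_{n+1}^{m-j}$ for $1\le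 i\le n$, and $g_{n+1}=0$. The Poincaré transform $f^*$ of $f$ with respect to $e_1$ is the vector field in the $n$ variables $x_2,\dots,x_{n+1}$ with components $-g_1(1,x_2,\dots,x_{n+1})\,x_i+g_i(1,x_2,\dots,x_{n+1})$, $2\le i\le n+1$. For $v\ne0$, a Poincaré transform of $f$ with respect to $v$ is $f_v^*=(T\circ f\circ T^{-1})^*$, where $T\in GL_n(\mathbb C)$ and $Tv=e_1$. The stationary points of $f_v^*$ with $x_{n+1}=0$ are the *stationary points at infinity*. The field $f$ has *property E* if, at every stationary point at infinity of every Poincaré transform, the eigenvalues $\lambda_1,\dots,\lambda_n$ (with multiplicity) of the linearization satisfy one of the following: (1) they are linearly independent over $\mathbb Q$; (2) $\dim_{\mathbb Q}(\mathbb Q\lambda_1+\cdots+\mathbb Q\lambda_n)=n-1$ and $\sum_i m_i\lambda_i=0$ for some positive integers $m_1,\dots,m_n$. **Proposition.** Let $\gamma_{13}=\gamma_{21}=\gamma_{32}=0$ and let the remaining six entries $\gamma_{11},\gamma_{12},\gamma_{22},\gamma_{23},\gamma_{31},\gamma_{33}$ be algebraically independent over $\mathbb Q$. Then there is exactly one distinguished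 homogeneous quadratic vector field $p$ with parameters $\gamma$; each of $x_1,x_2,x_3$ is a semi-invariant of $p$; and $p$ has property E. Consequently property E does not preclude invariant algebraic surfaces: there exists a homogeneous quadratic vector field on $\mathbb C^3$ that has property E and for which $x_1,x_2,x_3$ are semi-invariants. -/

import Mathlib

open MvPolynomial

noncomputable section

namespace PolyVF

/-- A polynomial vector field `f` on `ℂⁿ`, i.e. the differential equation `ẋ = f(x)`, given by its
component polynomials. -/
abbrev VectorField (n : ℕ) : Type := Fin n → MvPolynomial (Fin n) ℂ

/-- The degree `m` of `f = f⁽⁰⁾ + ⋯ + f⁽ᵐ⁾`, `f⁽ᵐ⁾ ≠ 0`. -/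
def VectorField.degree {n : ℕ} (f : VectorField n) : ℕ :=
  Finset.univ.sup fun i => (f i).totalDegree

/-- The Lie derivative `X_f(ψ) = ∑ᵢ fᵢ ∂ψ/∂xᵢ`. -/
def lieDeriv {n : ℕ} (f : VectorField n) (ψ : MvPolynomial (Fin n) ℂ) : MvPolynomial (Fin n) ℂ :=
  ∑ i, f i * pderiv i ψ

/-- `ψ` is a (polynomial) semi-invariant of `f`: it is nonconstant and `X_f(ψ) = μ ψ` for some
polynomial `μ` (the cofactor). -/
def IsSemiInvariant {n : ℕ} (f : VectorField n) (ψ : MvPolynomial (Fin n) ℂ) : Prop :=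
  (∀ c : ℂ, ψ ≠ C c) ∧ ∃ μ : MvPolynomial (Fin n) ℂ, lieDeriv f ψ = μ * ψ

/-- The Jacobian matrix `Df(z)`. -/
def jacobian {n : ℕ} (f : VectorField n) (z : Fin n → ℂ) : Matrix (Fin n) (Fin n) ℂ :=
  Matrix.of fun i j => eval z (pderiv j (f i))

/-- The conjugated vector field `T ∘ f ∘ T⁻¹`. -/
def conj {n : ℕ} (T : Matrix (Fin n) (Fin n) ℂ) (f : VectorField n) : VectorField n :=
  fun i => ∑ j, C (T i j) * aeval (fun l => ∑ r, C (T⁻¹ l r) * X r) (f j)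

/-- The homogenization of `f` on `ℂⁿ⁺¹`, with respect to the additional last variable: its
components are `∑ⱼ fᵢ⁽ʲ⁾(x₁,…,xₙ) xₙ₊₁ᵐ⁻ʲ` for `i ≤ n`, and the last component is `0`. -/
def homogenization {n : ℕ} (f : VectorField n) : VectorField (n + 1) :=
  Fin.snoc (α := fun _ => MvPolynomial (Fin (n + 1)) ℂ)
    (fun i => ∑ j ∈ Finset.range (f.degree + 1),
      rename Fin.castSucc (homogeneousComponent j (f i)) * X (Fin.last n) ^ (f.degree - j))
    0

/-- The special Poincaré transform `f*` of `f` with respect to `e₁`. With `(g₁, …, gₙ, 0)` the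
homogenization of `f`, and with the variables `x₂, …, xₙ₊₁`, the components of `f*` are
`-g₁(1, x₂, …, xₙ₊₁) xᵢ + gᵢ(1, x₂, …, xₙ₊₁)` for `2 ≤ i ≤ n`, and `-g₁(1, x₂, …, xₙ₊₁) xₙ₊₁`.
Here `n = k + 1`, and `X i` stands for `xᵢ₊₂` (`0 ≤ i ≤ k`). -/
def poincare {k : ℕ} (f : VectorField (k + 1)) : VectorField (k + 1) :=
  let g : Fin (k + 2) → MvPolynomial (Fin (k + 1)) ℂ := fun i =>
    aeval (Fin.cons (α := fun _ => MvPolynomial (Fin (k + 1)) ℂ) 1 fun l => X l)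
      (homogenization f i)
  fun i => -(g 0 * X i) + g i.succ

/-- First condition on the eigenvalues: `λ₁, …, λₙ` are linearly independent over `ℚ`. -/
def EigenCondition1 {n : ℕ} (ev : Fin n → ℂ) : Prop :=
  LinearIndependent ℚ ev

/-- Second condition on the eigenvalues: `λ₁, …, λₙ` span a `ℚ`-vector space of dimension `n - 1`
and satisfy `∑ mᵢ λᵢ = 0` for some positive integers `mᵢ`. -/
def EigenCondition2 {n : ℕ} (ev : Fin n → ℂ) : Prop :=
  Module.finrank ℚ (Submodule.span ℚ (Set.range ev)) + 1 = n ∧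
    ∃ m : Fin n → ℕ, (∀ i, 0 < m i) ∧ ∑ i, (m i : ℂ) * ev i = 0

/-- The eigenvalues of `B`, listed with their algebraic multiplicities, satisfy the first or the
second condition (neither depends on the order of the list). -/
def EigenCondition {n : ℕ} (B : Matrix (Fin n) (Fin n) ℂ) : Prop :=
  ∃ ev : Fin n → ℂ, B.charpoly.roots = Finset.univ.val.map ev ∧
    (EigenCondition1 ev ∨ EigenCondition2 ev)

/-- Property E: for every Poincaré transform `f*_v = (T ∘ f ∘ T⁻¹)*` of `f` (`v ≠ 0`, `T` invertible
with `T v = e₁`), and for every stationary point `z` of `f*_v` at infinity, i.e. lying in the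
hyperplane where the last coordinate is zero, the linearization of `f*_v` at `z` satisfies one of
the two eigenvalue conditions. -/
def PropertyE {k : ℕ} (f : VectorField (k + 1)) : Prop :=
  ∀ (v : Fin (k + 1) → ℂ) (T : Matrix (Fin (k + 1)) (Fin (k + 1)) ℂ),
    v ≠ 0 → IsUnit T → T.mulVec v = Pi.single 0 1 →
    ∀ z : Fin (k + 1) → ℂ, z (Fin.last k) = 0 →
      (∀ i, eval z (poincare (conj T f) i) = 0) →
      EigenCondition (jacobian (poincare (conj T f)) z)

/-- `v` is an idempotent of `p`: `p(v) = v ≠ 0`. -/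
def IsIdempotentOf {n : ℕ} (p : VectorField n) (v : Fin n → ℂ) : Prop :=
  v ≠ 0 ∧ ∀ k, eval v (p k) = v k

/-- The matrix `A` with rows `(γᵢ₁γᵢ₂, γᵢ₂γᵢ₃, γᵢ₃γᵢ₁)`. -/
def productMatrix (γ : Matrix (Fin 3) (Fin 3) ℂ) : Matrix (Fin 3) (Fin 3) ℂ :=
  Matrix.of fun i => ![γ i 0 * γ i 1, γ i 1 * γ i 2, γ i 2 * γ i 0]

/-- `p` is a distinguished homogeneous quadratic vector field in `ℂ³` with parameters `γ`: the
vectors `e₁, e₂, e₃` and `vᵢ = γᵢ₁e₁ + γᵢ₂e₂ + γᵢ₃e₃` (the rows of `γ`) are idempotents of `p`, and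
`A` is invertible. (The last condition forces the six idempotents to be distinct.) -/
structure IsDistinguished (γ : Matrix (Fin 3) (Fin 3) ℂ) (p : VectorField 3) : Prop where
  homogeneous : ∀ k, (p k).IsHomogeneous 2
  basis_idempotent : ∀ i : Fin 3, IsIdempotentOf p (Pi.single i 1)
  row_idempotent : ∀ i : Fin 3, IsIdempotentOf p (γ i)
  isUnit_productMatrix : IsUnit (productMatrix γ)

end PolyVF

end

open MvPolynomial

namespace PolyVF

/-! Each row of `γ` has exactly two nonzero entries, so the idempotents determine all square and
mixed coefficients, and `p` comes out as a Lotka–Volterra field whose interaction matrix `L` has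
unit diagonal. The off-diagonal entries of `L` have the form `(1 - a) / b`; the parameters can be
recovered rationally from them, so they too are algebraically independent.

A stationary point at infinity is a direction `u` with `p(u) = l u`. By Euler's identity `2l` is an
eigenvalue of `Dp(u)`; if the others are `μ + l` and `ν + l`, the linearization has eigenvalues `μ,
ν, -l` (`charpoly_jacobian_poincare`). According to the support of `u` (vertex, edge or interior of
the coordinate triangle), these are explicit in `L`, up to one quadratic equation in the interior. A
rational linear relation among them becomes a polynomial relation over `ℚ` in the entries of `L`,
which must vanish identically; a few rational specializations then kill its coefficients. So the
first eigenvalue condition always holds. -/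

/-! ### Algebraic independence over a base field -/

/-- A polynomial relation over `ℚ` between algebraically independent numbers persists under every
rational specialization. -/
theorem eval_eq_zero_of_algebraicIndependent {ι : Type*} {x : ι → ℂ}
    (hx : AlgebraicIndependent ℚ x) {P : MvPolynomial ι ℚ} (hP : aeval x P = 0) (y : ι → ℚ) :
    eval y P = 0 := by
  rw [hx.eq_zero_of_aeval_eq_zero P hP, map_zero]

/-- `K` is algebraic over `F(y)`, and `y` has no more members than the transcendence degree, so `y`
is a transcendence basis. -/
theorem algebraicIndependent_of_adjoin_eq_top {F K ι : Type*} [Field F] [Field K] [Algebra F K]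
    [Finite ι] {x y : ι → K} (hx : AlgebraicIndependent F x)
    (hy : IntermediateField.adjoin F (Set.range y) = ⊤) : AlgebraicIndependent F y := by
  have halg : Algebra.IsAlgebraic (Algebra.adjoin F (Set.range y)) K := by
    refine ⟨fun z => ?_⟩
    have hz : z ∈ IntermediateField.adjoin F (Set.range y) := hy ▸ IntermediateField.mem_top
    induction hz using IntermediateField.adjoin_induction with
    | mem z hz =>
      exact isAlgebraic_algebraMap
        (⟨z, Algebra.subset_adjoin hz⟩ : Algebra.adjoin F (Set.range y))
    | algebraMap a =>
      exact isAlgebraic_algebraMap (algebraMap F (Algebra.adjoin F (Set.range y)) a)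
    | add a b ha hb iha ihb => exact iha.add ihb
    | inv a ha iha => exact iha.inv
    | mul a b ha hb iha ihb => exact iha.mul ihb
  exact (Algebra.IsAlgebraic.isTranscendenceBasis_of_lift_le_trdeg_of_finite F y
    hx.lift_cardinalMk_le_trdeg).1

/-- A finite family `y` is algebraically independent as soon as the field it generates contains an
algebraically independent family with the same index type. -/
theorem algebraicIndependent_of_mem_adjoin {F E ι : Type*} [Field F] [Field E] [Algebra F E]
    [Finite ι] {x y : ι → E} (hx : AlgebraicIndependent F x)
    (hxy : ∀ i, x i ∈ IntermediateField.adjoin F (Set.range y)) : AlgebraicIndependent F y := by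
  have hy : ∀ i, y i ∈ IntermediateField.adjoin F (Set.range y) := fun i =>
    IntermediateField.subset_adjoin F _ ⟨i, rfl⟩
  generalize hK : IntermediateField.adjoin F (Set.range y) = K at hxy hy
  let y' : ι → K := fun i => ⟨y i, hy i⟩
  have hx' : AlgebraicIndependent F (fun i => (⟨x i, hxy i⟩ : K)) :=
    AlgebraicIndependent.of_comp K.val hx
  have htop : IntermediateField.adjoin F (Set.range y') = ⊤ := by
    apply IntermediateField.map_injective K.val
    rw [IntermediateField.adjoin_map, ← AlgHom.fieldRange_eq_map, IntermediateField.fieldRange_val,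
      ← Set.range_comp]
    exact hK
  have hy' : AlgebraicIndependent F y' := algebraicIndependent_of_adjoin_eq_top hx' htop
  have hval : Function.Injective K.val := K.val.injective
  have h : AlgebraicIndependent F (K.val ∘ y') := hy'.map' hval
  exact h

/-- A finite transcendence basis would make `ℂ` countable. -/
theorem exists_algebraicIndependent_complex (n : ℕ) :
    ∃ x : Fin n → ℂ, AlgebraicIndependent ℚ x := by
  obtain ⟨s, hs⟩ := exists_isTranscendenceBasis ℚ ℂ
  have hinf : Infinite s := by
    by_contra hfin
    have hfin : Finite s := not_infinite_iff_finite.mp hfin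
    have : Cardinal.lift.{0} (Cardinal.mk ℂ) ≤ Cardinal.aleph0 := by
      refine (IsAlgClosed.cardinal_le_max_transcendence_basis _ hs).trans ?_
      simp
    rw [Cardinal.lift_id] at this
    rw [Cardinal.mk_complex] at this
    exact absurd this (not_le.mpr Cardinal.aleph0_lt_continuum)
  exact ⟨_, hs.1.comp _ ((Fin.valEmbedding.trans (Infinite.natEmbedding s)).injective)⟩

/-! ### Rational independence of the eigenvalues, by support of the direction -/

theorem linearIndependent_vertex {x : Fin 2 → ℂ} (hx : AlgebraicIndependent ℚ x) {u : ℂ}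
    (hu : u ≠ 0) : LinearIndependent ℚ ![x 0 * u - u, x 1 * u - u, -u] := by
  rw [Fintype.linearIndependent_iff]
  intro n hn
  simp only [Fin.sum_univ_three, Matrix.cons_val, Algebra.smul_def, eq_ratCast] at hn
  have h := eval_eq_zero_of_algebraicIndependent hx
    (P := C (n 0) * (X 0 - 1) + C (n 1) * (X 1 - 1) - C (n 2)) (by
      apply mul_right_cancel₀ hu
      simp only [map_sub, map_add, map_mul, map_one, aeval_C, aeval_X, eq_ratCast, zero_mul]
      linear_combination hn)
  simp only [map_sub, map_add, map_mul, eval_C, eval_X, map_one] at h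
  have h₁ := h ![1, 1]
  have h₂ := h ![1, 0]
  have h₃ := h ![0, 1]
  simp at h₁ h₂ h₃
  intro i
  fin_cases i <;> simp <;> linarith

/-- The direction has two coordinates `u, v`. The first eigenvalue is transversal to the edge, with
`x 2, x 3` the couplings into the vanishing coordinate; the second lies along the edge and comes
from a trace. -/
theorem linearIndependent_edge {x : Fin 4 → ℂ} (hx : AlgebraicIndependent ℚ x) {u v l : ℂ}
    (h₁ : u + x 0 * v = l) (h₂ : x 1 * u + v = l) (huv : u ≠ 0 ∨ v ≠ 0) :
    l ≠ 0 ∧ LinearIndependent ℚ ![x 2 * u + x 3 * v - l, u + v - l, -l] := by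
  have hE : 1 - x 0 * x 1 ≠ 0 := by
    intro hE
    have := eval_eq_zero_of_algebraicIndependent hx (P := 1 - X 0 * X 1) (by simpa using hE) 0
    simp at this
  have hu : (1 - x 0 * x 1) * u = l * (1 - x 0) := by linear_combination h₁ - x 0 * h₂
  have hv : (1 - x 0 * x 1) * v = l * (1 - x 1) := by linear_combination h₂ - x 1 * h₁
  have hl : l ≠ 0 := by
    rintro rfl
    simp [hE] at hu hv
    simp [hu, hv] at huv
  refine ⟨hl, ?_⟩
  rw [Fintype.linearIndependent_iff]
  intro n hn
  simp only [Fin.sum_univ_three, Matrix.cons_val, Algebra.smul_def, eq_ratCast] at hn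
  have h := eval_eq_zero_of_algebraicIndependent hx
    (P := C (n 0) * (X 2 * (1 - X 0) + X 3 * (1 - X 1) - (1 - X 0 * X 1)) +
      C (n 1) * ((1 - X 0) + (1 - X 1) - (1 - X 0 * X 1)) - C (n 2) * (1 - X 0 * X 1)) (by
      apply mul_right_cancel₀ hl
      simp only [map_sub, map_add, map_mul, map_one, aeval_C, aeval_X, eq_ratCast, zero_mul]
      linear_combination (1 - x 0 * x 1) * hn - (n 0 * x 2 + n 1) * hu - (n 0 * x 3 + n 1) * hv)
  simp only [map_sub, map_add, map_mul, eval_C, eval_X, map_one] at h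
  -- These points yield `n 1 = n 2`, `n 1 = n 0 + n 2` and `n 2 = 0`.
  have h₁ := h ![0, 0, 1, 0]
  have h₂ := h ![0, 0, 0, 0]
  have h₃ := h ![1, 0, 0, 1]
  simp at h₁ h₂ h₃
  intro i
  fin_cases i <;> simp <;> linarith

/-- The matrix `diag(u, v, w) * L` has eigenvalues `l, μ, ν`; `hs` and `hp` record its trace and
determinant. -/
theorem linearIndependent_interior {x : Fin 6 → ℂ} (hx : AlgebraicIndependent ℚ x)
    {u v w l μ ν : ℂ} (h₁ : u + x 0 * v + x 5 * w = l) (h₂ : x 1 * u + v + x 2 * w = l)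
    (h₃ : x 4 * u + x 3 * v + w = l) (hne : u ≠ 0)
    (hs : μ + ν = u + v + w - l)
    (hp : l * (μ * ν) = u * v * w *
      (1 - x 2 * x 3 - x 0 * (x 1 - x 2 * x 4) + x 5 * (x 1 * x 3 - x 4))) :
    LinearIndependent ℚ ![μ, ν, -l] := by
  -- Cramer's rule: `D` is the determinant of `L`, and `U, V, W` are the numerators of `u, v, w` for
  -- right-hand side `(1, 1, 1)`.
  set D := 1 - x 2 * x 3 - x 0 * (x 1 - x 2 * x 4) + x 5 * (x 1 * x 3 - x 4) with hD
  set U := 1 - x 2 * x 3 - x 0 * (1 - x 2) + x 5 * (x 3 - 1) with hU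
  set V := 1 - x 2 - (x 1 - x 2 * x 4) + x 5 * (x 1 - x 4) with hV
  set W := 1 - x 3 - x 0 * (x 1 - x 4) + (x 1 * x 3 - x 4) with hW
  have hD0 : D ≠ 0 := by
    intro h
    have := eval_eq_zero_of_algebraicIndependent hx
      (P := 1 - X 2 * X 3 - X 0 * (X 1 - X 2 * X 4) + X 5 * (X 1 * X 3 - X 4))
      (by simpa using h) 0
    simp at this
  have hu : D * u = l * U := by
    rw [hD, hU]
    linear_combination (1 - x 2 * x 3) * h₁ + (x 3 * x 5 - x 0) * h₂ + (x 0 * x 2 - x 5) * h₃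
  have hv : D * v = l * V := by
    rw [hD, hV]
    linear_combination (x 2 * x 4 - x 1) * h₁ + (1 - x 4 * x 5) * h₂ + (x 1 * x 5 - x 2) * h₃
  have hw : D * w = l * W := by
    rw [hD, hW]
    linear_combination (x 1 * x 3 - x 4) * h₁ + (x 0 * x 4 - x 3) * h₂ + (1 - x 0 * x 1) * h₃
  have hl : l ≠ 0 := by
    rintro rfl
    simp [hD0, hne] at hu
  rw [Fintype.linearIndependent_iff]
  intro n hn
  simp only [Fin.sum_univ_three, Matrix.cons_val, Algebra.smul_def, eq_ratCast] at hn
  have hsum : D * (μ + ν) = l * (U + V + W - D) := by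
    linear_combination D * hs + hu + hv + hw
  have hprod : D ^ 2 * (l * (μ * ν)) = l ^ 3 * (U * V * W) := by
    calc D ^ 2 * (l * (μ * ν)) = (D * u) * (D * v) * (D * w) := by rw [hp]; ring
      _ = _ := by rw [hu, hv, hw]; ring
  -- The relation is multiplied by its conjugate under `μ ↔ ν`, leaving only `μ + ν` and `μ * ν`,
  -- which are rational in `L` up to powers of `l`.
  have key : (n 2 : ℂ) ^ 2 * D ^ 2 - n 2 * (n 0 + n 1) * D * (U + V + W - D)
      + n 0 * n 1 * (U + V + W - D) ^ 2 + (n 0 - n 1) ^ 2 * (U * V * W) = 0 := by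
    have hl3 : l ^ 3 ≠ 0 := pow_ne_zero 3 hl
    apply mul_left_cancel₀ hl3
    linear_combination D ^ 2 * l * (n 0 * ν + n 1 * μ - n 2 * l) * hn
      + (n 2 * (n 0 + n 1) * D * l ^ 2 - n 0 * n 1 * l * (D * (μ + ν) + l * (U + V + W - D))) * hsum
      - (n 0 - n 1) ^ 2 * hprod
  let d : MvPolynomial (Fin 6) ℚ :=
    1 - X 2 * X 3 - X 0 * (X 1 - X 2 * X 4) + X 5 * (X 1 * X 3 - X 4)
  let p : MvPolynomial (Fin 6) ℚ := 1 - X 2 * X 3 - X 0 * (1 - X 2) + X 5 * (X 3 - 1)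
  let q : MvPolynomial (Fin 6) ℚ := 1 - X 2 - (X 1 - X 2 * X 4) + X 5 * (X 1 - X 4)
  let r : MvPolynomial (Fin 6) ℚ := 1 - X 3 - X 0 * (X 1 - X 4) + (X 1 * X 3 - X 4)
  have h := eval_eq_zero_of_algebraicIndependent hx
    (P := C (n 2) ^ 2 * d ^ 2 - C (n 2) * (C (n 0) + C (n 1)) * d * (p + q + r - d)
      + C (n 0) * C (n 1) * (p + q + r - d) ^ 2 + (C (n 0) - C (n 1)) ^ 2 * (p * q * r)) (by
      simpa [d, p, q, r] using key)
  simp only [d, p, q, r, map_sub, map_add, map_mul, map_pow, eval_C, eval_X, map_one] at h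
  -- At this circulant point `D = 9` and `U = V = W = 3`, so `U + V + W - D = 0` and what remains is
  -- the definite form `81 (n 2)² + 27 (n 0 - n 1)²`. The origin then gives `4 (n 1)² = 0`.
  have h₄ := h ![2, 0, 2, 0, 2, 0]
  have h₅ := h 0
  simp at h₄ h₅
  ring_nf at h₄
  have hn2 : n 2 = 0 := by
    nlinarith [sq_nonneg (n 2), sq_nonneg (n 0 - n 1)]
  have hn01 : n 0 = n 1 := by
    have : (n 0 - n 1) ^ 2 = 0 := by nlinarith [sq_nonneg (n 2), sq_nonneg (n 0 - n 1)]
    exact sub_eq_zero.mp (pow_eq_zero_iff two_ne_zero |>.mp this)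
  rw [hn2, hn01] at h₅
  have hn1 : n 1 = 0 := by
    have : (n 1) ^ 2 = 0 := by linarith
    exact pow_eq_zero_iff two_ne_zero |>.mp this
  intro i
  fin_cases i
  · exact hn01.trans hn1
  · exact hn1
  · exact hn2

/-! ### Chain rule and linear conjugation -/

theorem pderiv_aeval {σ τ R : Type*} [CommSemiring R] [Fintype σ] (s : σ → MvPolynomial τ R)
    (p : MvPolynomial σ R) (t : τ) :
    pderiv t (aeval s p) = ∑ i, aeval s (pderiv i p) * pderiv t (s i) := by
  classical
  induction p using MvPolynomial.induction_on with
  | C a => simp [algebraMap_eq]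
  | add p q hp hq => simp only [map_add, hp, hq, add_mul, Finset.sum_add_distrib]
  | mul_X p i hp =>
    have h : ∀ j, aeval s (pderiv j (p * X i)) * pderiv t (s j) =
        s i * (aeval s (pderiv j p) * pderiv t (s j)) +
          if j = i then aeval s p * pderiv t (s i) else 0 := by
      intro j
      split_ifs with hj
      · subst hj
        simp only [pderiv_mul, pderiv_X_self, map_add, map_mul, aeval_X, mul_one]
        ring
      · simp only [pderiv_mul, pderiv_X_of_ne (Ne.symm hj), map_add, map_mul, aeval_X, mul_zero,
          map_zero]
        ring
    simp only [h, Finset.sum_add_distrib, ← Finset.mul_sum, ← hp, Finset.sum_ite_eq',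
      Finset.mem_univ, if_true]
    simp only [map_mul, aeval_X, pderiv_mul]
    ring

theorem eval_aeval_linear {n : ℕ} (S : Matrix (Fin n) (Fin n) ℂ) (w : Fin n → ℂ)
    (p : MvPolynomial (Fin n) ℂ) :
    eval w (aeval (fun l => ∑ r, C (S l r) * X r) p) = eval (S.mulVec w) p := by
  induction p using MvPolynomial.induction_on with
  | C a => simp [algebraMap_eq]
  | add p q hp hq => simp only [map_add, hp, hq]
  | mul_X p i hp => simp only [map_mul, hp, aeval_X, map_sum, eval_C, eval_X, Matrix.mulVec,
      dotProduct]

theorem eval_conj {n : ℕ} (T : Matrix (Fin n) (Fin n) ℂ) (f : VectorField n) (w : Fin n → ℂ) :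
    (fun i => eval w (conj T f i)) = T.mulVec fun j => eval (T⁻¹.mulVec w) (f j) := by
  ext i
  simp only [conj, map_sum, map_mul, eval_C, Matrix.mulVec, dotProduct]
  refine Finset.sum_congr rfl fun j _ => ?_
  congr 1
  exact eval_aeval_linear _ _ _

theorem jacobian_conj {n : ℕ} (T : Matrix (Fin n) (Fin n) ℂ) (f : VectorField n)
    (w : Fin n → ℂ) :
    jacobian (conj T f) w = T * jacobian f (T⁻¹.mulVec w) * T⁻¹ := by
  have hlin : ∀ l k, pderiv k (∑ r, C (T⁻¹ l r) * X r : MvPolynomial (Fin n) ℂ) = C (T⁻¹ l k) := by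
    intro l k
    simp [pderiv_X, Pi.single_apply]
  ext i k
  simp only [jacobian, Matrix.of_apply, conj, map_sum, pderiv_C_mul, pderiv_aeval, hlin,
    Matrix.mul_apply, map_mul, eval_C, eval_aeval_linear, Finset.sum_mul, Finset.mul_sum]
  rw [Finset.sum_comm]
  exact Finset.sum_congr rfl fun j _ => Finset.sum_congr rfl fun l _ => (mul_assoc _ _ _).symm

theorem conj_isHomogeneous {n d : ℕ} (T : Matrix (Fin n) (Fin n) ℂ) {f : VectorField n}
    (hf : ∀ i, (f i).IsHomogeneous d) (i : Fin n) : (conj T f i).IsHomogeneous d := by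
  refine IsHomogeneous.sum _ _ _ fun j _ => ?_
  have h := (hf j).aeval (τ := Fin n) (fun l => ∑ r, C (T⁻¹ l r) * X r) (n := 1) fun l =>
    IsHomogeneous.sum _ _ _ fun r _ => by
      simpa using (isHomogeneous_C (Fin n) (T⁻¹ l r)).mul (isHomogeneous_X ℂ r)
  simpa using (isHomogeneous_C (Fin n) (T i j)).mul h

/-! ### Poincaré transforms of homogeneous fields -/

/-- The zero field is homogeneous of every degree but has `degree` equal to `0`, hence `hne`. -/
theorem degree_eq_of_isHomogeneous {n d : ℕ} {f : VectorField n}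
    (hf : ∀ i, (f i).IsHomogeneous d) (hne : f ≠ 0) : f.degree = d := by
  obtain ⟨i, hi⟩ := Function.ne_iff.mp hne
  refine le_antisymm (Finset.sup_le fun j _ => (hf j).totalDegree_le) ?_
  rw [← (hf i).totalDegree hi]
  exact Finset.le_sup (f := fun i => (f i).totalDegree) (Finset.mem_univ i)

theorem homogenization_castSucc {n d : ℕ} {f : VectorField n}
    (hf : ∀ i, (f i).IsHomogeneous d) (hne : f ≠ 0) (i : Fin n) :
    homogenization f i.castSucc = rename Fin.castSucc (f i) := by
  simp only [homogenization, Fin.snoc_castSucc, degree_eq_of_isHomogeneous hf hne]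
  rw [Finset.sum_range_succ, Finset.sum_eq_zero]
  · simp [homogeneousComponent_of_mem (hf i)]
  · intro j hj
    simp [homogeneousComponent_of_mem (hf i), (Finset.mem_range.mp hj).ne]

theorem homogenization_last {n : ℕ} (f : VectorField n) :
    homogenization f (Fin.last n) = 0 := by
  simp [homogenization]

/-- The point `(1, z₁, …, zₖ)`, for `z = (z₁, …, zₖ, zₖ₊₁)`. -/
def affinePoint {k : ℕ} (z : Fin (k + 1) → ℂ) : Fin (k + 1) → ℂ :=
  Fin.cons (α := fun _ => ℂ) 1 fun l : Fin k => z l.castSucc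

/-- The restriction of a polynomial to the affine chart `x₁ = 1`. -/
noncomputable def dehomogenize {k : ℕ} (p : MvPolynomial (Fin (k + 1)) ℂ) : MvPolynomial (Fin (k + 1)) ℂ :=
  aeval (Fin.cons (α := fun _ => MvPolynomial (Fin (k + 1)) ℂ) 1 fun l : Fin k => X l.castSucc) p

theorem eval_dehomogenize {k : ℕ} (p : MvPolynomial (Fin (k + 1)) ℂ) (z : Fin (k + 1) → ℂ) :
    eval z (dehomogenize p) = eval (affinePoint z) p := by
  unfold dehomogenize
  induction p using MvPolynomial.induction_on with
  | C a => simp [algebraMap_eq]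
  | add p q hp hq => simp only [map_add, hp, hq]
  | mul_X p i hp =>
    simp only [map_mul, hp, aeval_X, eval_X]
    congr 1
    refine Fin.cases ?_ (fun l => ?_) i <;> simp [affinePoint]

theorem pderiv_dehomogenize_castSucc {k : ℕ} (p : MvPolynomial (Fin (k + 1)) ℂ) (j : Fin k) :
    pderiv j.castSucc (dehomogenize p) = dehomogenize (pderiv j.succ p) := by
  simp only [dehomogenize, pderiv_aeval]
  rw [Fin.sum_univ_succ]
  simp [pderiv_X, Pi.single_apply]

theorem pderiv_dehomogenize_last {k : ℕ} (p : MvPolynomial (Fin (k + 1)) ℂ) :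
    pderiv (Fin.last k) (dehomogenize p) = 0 := by
  simp only [dehomogenize, pderiv_aeval]
  rw [Fin.sum_univ_succ]
  simp [pderiv_X, Fin.ext_iff, fun x : Fin k => x.2.ne]

theorem aeval_homogenization_castSucc {k d : ℕ} {f : VectorField (k + 1)}
    (hf : ∀ i, (f i).IsHomogeneous d) (hne : f ≠ 0) (i : Fin (k + 1)) :
    aeval (Fin.cons (α := fun _ => MvPolynomial (Fin (k + 1)) ℂ) 1 fun l => X l)
      (homogenization f i.castSucc) = dehomogenize (f i) := by
  rw [homogenization_castSucc hf hne, aeval_rename, dehomogenize]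
  congr 2
  ext1 l
  refine Fin.cases ?_ (fun l => ?_) l
  · simp
  · simp

theorem poincare_castSucc {k d : ℕ} {f : VectorField (k + 1)}
    (hf : ∀ i, (f i).IsHomogeneous d) (hne : f ≠ 0) (i : Fin k) :
    poincare f i.castSucc =
      -(dehomogenize (f 0) * X i.castSucc) + dehomogenize (f i.succ) := by
  have h0 := aeval_homogenization_castSucc hf hne 0
  have hi := aeval_homogenization_castSucc hf hne i.succ
  rw [Fin.castSucc_zero] at h0
  simp only [poincare, h0, Fin.succ_castSucc, hi]

theorem poincare_last {k d : ℕ} {f : VectorField (k + 1)}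
    (hf : ∀ i, (f i).IsHomogeneous d) (hne : f ≠ 0) :
    poincare f (Fin.last k) = -(dehomogenize (f 0) * X (Fin.last k)) := by
  have h0 := aeval_homogenization_castSucc hf hne 0
  rw [Fin.castSucc_zero] at h0
  simp only [poincare, h0, Fin.succ_last, homogenization_last, map_zero, add_zero]

theorem affinePoint_ne_zero {k : ℕ} (z : Fin (k + 1) → ℂ) : affinePoint z ≠ 0 := fun h => by
  simpa [affinePoint] using congrFun h 0

/-- At a stationary point at infinity, the corresponding direction is mapped to a multiple of
itself. -/
theorem eval_affinePoint_of_stationary {k d : ℕ} {f : VectorField (k + 1)}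
    (hf : ∀ i, (f i).IsHomogeneous d) (hne : f ≠ 0) {z : Fin (k + 1) → ℂ}
    (hz : ∀ i, eval z (poincare f i) = 0) (i : Fin (k + 1)) :
    eval (affinePoint z) (f i) = eval (affinePoint z) (f 0) * affinePoint z i := by
  refine Fin.cases (by simp [affinePoint]) (fun i => ?_) i
  have h := hz i.castSucc
  rw [poincare_castSucc hf hne] at h
  simp only [map_add, map_neg, map_mul, eval_X, eval_dehomogenize] at h
  simp only [affinePoint, Fin.cons_succ] at h ⊢
  linear_combination h

theorem jacobian_mulVec_of_isHomogeneous {n d : ℕ} {f : VectorField n}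
    (hf : ∀ i, (f i).IsHomogeneous d) (w : Fin n → ℂ) (i : Fin n) :
    ∑ j, jacobian f w i j * w j = d * eval w (f i) := by
  have h := congrArg (eval w) (hf i).sum_X_mul_pderiv
  simp only [map_sum, map_mul, eval_X, nsmul_eq_mul, map_natCast] at h
  rw [← h]
  exact Finset.sum_congr rfl fun j _ => mul_comm _ _

/-- The linearization of the Poincaré transform of a quadratic homogeneous field in `ℂ³` at a
stationary point at infinity, in terms of the Jacobian of the field itself. -/
theorem charpoly_jacobian_poincare {f : VectorField 3} (hf : ∀ i, (f i).IsHomogeneous 2)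
    (hne : f ≠ 0) {z : Fin 3 → ℂ} (hz2 : z 2 = 0) (hz : ∀ i, eval z (poincare f i) = 0) {l : ℂ}
    (hl : l = eval (affinePoint z) (f 0)) :
    (jacobian (poincare f) z).charpoly * (Polynomial.X - Polynomial.C l) =
      (jacobian f (affinePoint z)).charpoly.comp (Polynomial.X + Polynomial.C l) *
        (Polynomial.X + Polynomial.C l) := by
  set w := affinePoint z with hw
  set M := jacobian f w with hM
  have hw0 : w 0 = 1 := rfl
  have hw1 : w 1 = z 0 := rfl
  have hw2 : w 2 = z 1 := rfl
  have hstat : ∀ i, eval w (f i) = l * w i := by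
    rw [hl]; exact eval_affinePoint_of_stationary hf hne hz
  -- Euler's identity `M w = 2 l w`, solved for the first column since `w 0 = 1`.
  have hcol : ∀ i, M i 0 = (l + l) * w i - M i 1 * z 0 - M i 2 * z 1 := by
    intro i
    have h := jacobian_mulVec_of_isHomogeneous hf w i
    rw [hstat, Fin.sum_univ_three, hw0, hw1, hw2] at h
    push_cast at h
    linear_combination h
  have hJ : jacobian (poincare f) z =
      !![-(M 0 1 * z 0) - l + M 1 1, -(M 0 2 * z 0) + M 1 2, 0;
        -(M 0 1 * z 1) + M 2 1, -(M 0 2 * z 1) - l + M 2 2, 0;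
        0, 0, -l] := by
    have h0 := poincare_castSucc hf hne 0
    have h1 := poincare_castSucc hf hne 1
    have h2 := poincare_last hf hne
    have d0 : ∀ p : MvPolynomial (Fin 3) ℂ,
        pderiv 0 (dehomogenize p) = dehomogenize (pderiv 1 p) :=
      fun p => pderiv_dehomogenize_castSucc p 0
    have d1 : ∀ p : MvPolynomial (Fin 3) ℂ,
        pderiv 1 (dehomogenize p) = dehomogenize (pderiv 2 p) :=
      fun p => pderiv_dehomogenize_castSucc p 1
    have d2 : ∀ p : MvPolynomial (Fin 3) ℂ, pderiv 2 (dehomogenize p) = 0 :=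
      pderiv_dehomogenize_last
    change poincare f 0 = -(dehomogenize (f 0) * X 0) + dehomogenize (f 1) at h0
    change poincare f 1 = -(dehomogenize (f 0) * X 1) + dehomogenize (f 2) at h1
    change poincare f 2 = -(dehomogenize (f 0) * X 2) at h2
    have hl' : eval w (f 0) = l := hl.symm
    ext i j
    fin_cases i <;> fin_cases j <;>
      simp [jacobian, h0, h1, h2, d0, d1, d2, eval_dehomogenize, ← hw, hl', hM,
        hz2, pderiv_X] <;> ring
  have h00 := hcol 0
  have h10 := hcol 1
  have h20 := hcol 2
  rw [hw0] at h00
  rw [hw1] at h10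
  rw [hw2] at h20
  -- The upper block of `hJ` is `M - l` acting modulo the eigenvector `w`. On `w` itself `M - l`
  -- acts as `l`, whence the factor `X - l`; the last diagonal entry `-l` gives `X + l`.
  rw [hJ, Matrix.charpoly, Matrix.charpoly, Matrix.det_fin_three, Matrix.det_fin_three]
  simp [h00, h10, h20]
  ring

/-! ### Lotka–Volterra fields and their eigenvalues -/

/-- The Lotka–Volterra field with interaction matrix `L`. -/
noncomputable def lotkaVolterra (L : Matrix (Fin 3) (Fin 3) ℂ) : VectorField 3 :=
  fun i => X i * ∑ j, C (L i j) * X j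

theorem lotkaVolterra_isHomogeneous (L : Matrix (Fin 3) (Fin 3) ℂ) (i : Fin 3) :
    (lotkaVolterra L i).IsHomogeneous 2 :=
  (isHomogeneous_X ℂ i).mul (n := 1) (IsHomogeneous.sum _ _ 1 fun j _ => by
    simpa using (isHomogeneous_C (Fin 3) (L i j)).mul (isHomogeneous_X ℂ j))

theorem eval_lotkaVolterra (L : Matrix (Fin 3) (Fin 3) ℂ) (u : Fin 3 → ℂ) (i : Fin 3) :
    eval u (lotkaVolterra L i) = u i * (L i 0 * u 0 + L i 1 * u 1 + L i 2 * u 2) := by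
  simp [lotkaVolterra, Fin.sum_univ_three]

theorem isSemiInvariant_lotkaVolterra (L : Matrix (Fin 3) (Fin 3) ℂ) (i : Fin 3) :
    IsSemiInvariant (lotkaVolterra L) (X i) := by
  refine ⟨fun c hc => ?_, ∑ j, C (L i j) * X j, ?_⟩
  · have h := congrArg (eval fun _ => c + 1) hc
    simp at h
  · simp [lieDeriv, pderiv_X, Pi.single_apply, lotkaVolterra, mul_comm]

theorem jacobian_lotkaVolterra (L : Matrix (Fin 3) (Fin 3) ℂ) (u : Fin 3 → ℂ) :
    jacobian (lotkaVolterra L) u =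
      Matrix.of fun i j => u i * L i j +
        if i = j then L i 0 * u 0 + L i 1 * u 1 + L i 2 * u 2 else 0 := by
  ext i j
  fin_cases i <;> fin_cases j <;>
    simp [jacobian, lotkaVolterra, pderiv_X, Fin.sum_univ_three]

theorem charpoly_eq_of_invariants {M : Matrix (Fin 3) (Fin 3) ℂ} {a b c : ℂ}
    (h₁ : M 0 0 + M 1 1 + M 2 2 = a + b + c)
    (h₂ : M 0 0 * M 1 1 - M 0 1 * M 1 0 + (M 1 1 * M 2 2 - M 1 2 * M 2 1) +
      (M 0 0 * M 2 2 - M 0 2 * M 2 0) = a * b + b * c + a * c)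
    (h₃ : M.det = a * b * c) :
    M.charpoly = (Polynomial.X - Polynomial.C a) * (Polynomial.X - Polynomial.C b) *
      (Polynomial.X - Polynomial.C c) := by
  rw [Matrix.det_fin_three] at h₃
  have e₁ := congrArg Polynomial.C h₁
  have e₂ := congrArg Polynomial.C h₂
  have e₃ := congrArg Polynomial.C h₃
  simp only [map_add, map_sub, map_mul] at e₁ e₂ e₃
  rw [Matrix.charpoly, Matrix.det_fin_three]
  simp
  linear_combination (-Polynomial.X ^ 2) * e₁ + Polynomial.X * e₂ - e₃

theorem exists_add_eq_mul_eq (s p : ℂ) : ∃ μ ν : ℂ, μ + ν = s ∧ μ * ν = p := by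
  obtain ⟨r, hr⟩ := IsAlgClosed.exists_pow_nat_eq (s ^ 2 - 4 * p) two_pos
  exact ⟨(s + r) / 2, (s - r) / 2, by ring, by linear_combination (-1 / 4 : ℂ) * hr⟩

/-- On the support of `u` the equations reduce to `(L u) i = l`, so there the Jacobian rows are
those of `diag(u) * L + l`. A row with `u i = 0` is diagonal, with entry `(L u) i`. -/
theorem exists_charpoly_jacobian_lotkaVolterra {L : Matrix (Fin 3) (Fin 3) ℂ}
    (hdiag : ∀ i, L i i = 1)
    (hL : AlgebraicIndependent ℚ ![L 0 1, L 1 0, L 1 2, L 2 1, L 2 0, L 0 2])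
    {u : Fin 3 → ℂ} (hu : u ≠ 0) {l : ℂ}
    (hul : ∀ i, eval u (lotkaVolterra L i) = l * u i) :
    ∃ μ ν : ℂ, (jacobian (lotkaVolterra L) u).charpoly =
      (Polynomial.X - Polynomial.C (l + l)) * (Polynomial.X - Polynomial.C (μ + l)) *
        (Polynomial.X - Polynomial.C (ν + l)) ∧ LinearIndependent ℚ ![μ, ν, -l] := by
  have hsub : ∀ {n : ℕ} (s : Fin n → Fin 6), Function.Injective s →
      AlgebraicIndependent ℚ (![L 0 1, L 1 0, L 1 2, L 2 1, L 2 0, L 0 2] ∘ s) :=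
    fun s hs => hL.comp s hs
  have d0 := hdiag 0
  have d1 := hdiag 1
  have d2 := hdiag 2
  have h0 := hul 0
  have h1 := hul 1
  have h2 := hul 2
  rw [eval_lotkaVolterra] at h0 h1 h2
  rw [jacobian_lotkaVolterra]
  by_cases u0 : u 0 = 0 <;> by_cases u1 : u 1 = 0 <;> by_cases u2 : u 2 = 0
  · exact absurd (_root_.funext fun i => by fin_cases i <;> assumption) hu
  · have hl : u 2 = l := mul_left_cancel₀ u2 (by simpa [u0, u1, d2, mul_comm] using h2)
    refine ⟨L 1 2 * u 2 - u 2, L 0 2 * u 2 - u 2, charpoly_eq_of_invariants ?_ ?_ ?_, hl ▸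
      linearIndependent_vertex (hsub ![2, 5] (by decide)) u2⟩
    all_goals
      simp [Matrix.det_fin_three, u0, u1, d0, d1, d2, ← hl]
      try ring1
  · have hl : u 1 = l := mul_left_cancel₀ u1 (by simpa [u0, u2, d1, mul_comm] using h1)
    refine ⟨L 0 1 * u 1 - u 1, L 2 1 * u 1 - u 1, charpoly_eq_of_invariants ?_ ?_ ?_, hl ▸
      linearIndependent_vertex (hsub ![0, 3] (by decide)) u1⟩
    all_goals
      simp [Matrix.det_fin_three, u0, u2, d0, d1, d2, ← hl]
      try first | ring1 | exact .inl (by ring)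
  · have e1 : u 1 + L 1 2 * u 2 = l :=
      mul_left_cancel₀ u1 (by simpa [u0, d1, mul_comm] using h1)
    have e2 : L 2 1 * u 1 + u 2 = l :=
      mul_left_cancel₀ u2 (by simpa [u0, d2, mul_comm] using h2)
    -- The index vector lists first the two couplings inside the edge, then the two into the
    -- vanishing coordinate; the other edges follow the same convention.
    refine ⟨L 0 1 * u 1 + L 0 2 * u 2 - l, u 1 + u 2 - l, charpoly_eq_of_invariants ?_ ?_ ?_,
      (linearIndependent_edge (hsub ![2, 3, 0, 5] (by decide)) e1 e2 (.inl u1)).2⟩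
    all_goals simp [Matrix.det_fin_three, u0, d0, d1, d2, e1, e2]
    · ring
    · linear_combination (-L 2 1 * u 1) * e1 - (l - u 1) * e2
    · linear_combination (L 0 1 * u 1 + L 0 2 * u 2) *
        ((-L 2 1 * u 1) * e1 - (l - u 1) * e2)
  · have hl : u 0 = l := mul_left_cancel₀ u0 (by simpa [u1, u2, d0, mul_comm] using h0)
    refine ⟨L 1 0 * u 0 - u 0, L 2 0 * u 0 - u 0, charpoly_eq_of_invariants ?_ ?_ ?_, hl ▸
      linearIndependent_vertex (hsub ![1, 4] (by decide)) u0⟩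
    all_goals
      simp [Matrix.det_fin_three, u1, u2, d0, d1, d2, ← hl]
      try ring1
  · have e2 : u 2 + L 2 0 * u 0 = l :=
      mul_left_cancel₀ u2 (by simpa [u1, d2, mul_comm, add_comm] using h2)
    have e0 : L 0 2 * u 2 + u 0 = l :=
      mul_left_cancel₀ u0 (by simpa [u1, d0, mul_comm, add_comm] using h0)
    refine ⟨L 1 2 * u 2 + L 1 0 * u 0 - l, u 2 + u 0 - l, charpoly_eq_of_invariants ?_ ?_ ?_,
      (linearIndependent_edge (hsub ![4, 5, 2, 1] (by decide)) e2 e0 (.inl u2)).2⟩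
    all_goals simp [Matrix.det_fin_three, u1, d0, d1, d2, add_comm (u 0), e0,
      add_comm _ (u 2), e2]
    · ring
    · linear_combination (-L 0 2 * u 2) * e2 - (l - u 2) * e0
    · linear_combination (L 1 2 * u 2 + L 1 0 * u 0) *
        ((-L 0 2 * u 2) * e2 - (l - u 2) * e0)
  · have e0 : u 0 + L 0 1 * u 1 = l :=
      mul_left_cancel₀ u0 (by simpa [u2, d0, mul_comm] using h0)
    have e1 : L 1 0 * u 0 + u 1 = l :=
      mul_left_cancel₀ u1 (by simpa [u2, d1, mul_comm] using h1)
    refine ⟨L 2 0 * u 0 + L 2 1 * u 1 - l, u 0 + u 1 - l, charpoly_eq_of_invariants ?_ ?_ ?_,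
      (linearIndependent_edge (hsub ![0, 1, 4, 3] (by decide)) e0 e1 (.inl u0)).2⟩
    all_goals simp [Matrix.det_fin_three, u2, d0, d1, d2, e0, e1]
    · ring
    · linear_combination (-L 1 0 * u 0) * e0 - (l - u 0) * e1
    · linear_combination (L 2 0 * u 0 + L 2 1 * u 1) *
        ((-L 1 0 * u 0) * e0 - (l - u 0) * e1)
  · have e0 : u 0 + L 0 1 * u 1 + L 0 2 * u 2 = l :=
      mul_left_cancel₀ u0 (by simpa [d0, mul_comm] using h0)
    have e1 : L 1 0 * u 0 + u 1 + L 1 2 * u 2 = l :=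
      mul_left_cancel₀ u1 (by simpa [d1, mul_comm] using h1)
    have e2 : L 2 0 * u 0 + L 2 1 * u 1 + u 2 = l :=
      mul_left_cancel₀ u2 (by simpa [d2, mul_comm] using h2)
    -- The prescribed sum and product match the trace and the sum of principal `2 × 2` minors of
    -- `diag(u) * L` to the eigenvalues `l, μ, ν`.
    obtain ⟨μ, ν, hs, hp⟩ := exists_add_eq_mul_eq (u 0 + u 1 + u 2 - l)
      (u 0 * u 1 * (1 - L 0 1 * L 1 0) + u 1 * u 2 * (1 - L 1 2 * L 2 1) +
        u 0 * u 2 * (1 - L 0 2 * L 2 0) - l * (u 0 + u 1 + u 2 - l))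
    have hdet : l * (μ * ν) = u 0 * u 1 * u 2 * (1 - L 1 2 * L 2 1 -
        L 0 1 * (L 1 0 - L 1 2 * L 2 0) + L 0 2 * (L 1 0 * L 2 1 - L 2 0)) := by
      rw [hp]
      linear_combination
        (-l * u 0 * L 2 0 + u 0 * u 1 * L 2 0 - L 1 0 * u 0 * L 2 1 * u 1) * e0
        + (-l * u 1 * L 0 1 + u 1 * u 2 * L 0 1
          - (l - u 0 - L 0 1 * u 1) * L 2 1 * u 1) * e1
        + (-l * u 2 * L 1 2 + u 0 * u 2 * L 1 2
          - (l - u 0 - L 0 1 * u 1) * (l - u 1 - L 1 2 * u 2)) * e2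
    refine ⟨μ, ν, charpoly_eq_of_invariants ?_ ?_ ?_,
      linearIndependent_interior hL e0 e1 e2 u0 hs hdet⟩
    all_goals simp [Matrix.det_fin_three, d0, d1, d2, e0, e1, e2]
    · linear_combination -hs
    · linear_combination (-3 * l) * hs - hp
    · linear_combination (-2 * l ^ 2) * hs - l * hp - hdet

/-! ### Property E for Lotka–Volterra fields -/

theorem conj_ne_zero {n : ℕ} {T : Matrix (Fin n) (Fin n) ℂ} (hT : IsUnit T) {f : VectorField n}
    (hf : f ≠ 0) : conj T f ≠ 0 := by
  have hdet := (Matrix.isUnit_iff_isUnit_det T).mp hT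
  intro h
  apply hf
  ext1 i
  refine MvPolynomial.funext fun x => ?_
  have hx := eval_conj T f (T.mulVec x)
  rw [h, Matrix.mulVec_mulVec, Matrix.nonsing_inv_mul T hdet, Matrix.one_mulVec] at hx
  have hx' := congrArg T⁻¹.mulVec hx
  rw [Matrix.mulVec_mulVec, Matrix.nonsing_inv_mul T hdet, Matrix.one_mulVec] at hx'
  have := congrFun hx' i
  simpa [Matrix.mulVec, dotProduct] using this.symm

theorem charpoly_jacobian_conj {n : ℕ} {T : Matrix (Fin n) (Fin n) ℂ} (hT : IsUnit T)
    (f : VectorField n) (w : Fin n → ℂ) :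
    (jacobian (conj T f) w).charpoly = (jacobian f (T⁻¹.mulVec w)).charpoly := by
  have hdet := (Matrix.isUnit_iff_isUnit_det T).mp hT
  rw [jacobian_conj, Matrix.charpoly_mul_comm, ← mul_assoc, Matrix.nonsing_inv_mul T hdet, one_mul]

theorem propertyE_lotkaVolterra {L : Matrix (Fin 3) (Fin 3) ℂ} (hdiag : ∀ i, L i i = 1)
    (hL : AlgebraicIndependent ℚ ![L 0 1, L 1 0, L 1 2, L 2 1, L 2 0, L 0 2]) :
    PropertyE (lotkaVolterra L) := by
  intro v T _ hT _ z hz2 hz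
  have hdet := (Matrix.isUnit_iff_isUnit_det T).mp hT
  have hne : lotkaVolterra L ≠ 0 := by
    intro h
    have := eval_lotkaVolterra L (Pi.single 0 1) 0
    simp [h, hdiag] at this
  have hq := conj_isHomogeneous T (lotkaVolterra_isHomogeneous L)
  have hqne := conj_ne_zero hT hne
  have hchar := charpoly_jacobian_poincare hq hqne hz2 hz rfl
  rw [charpoly_jacobian_conj hT] at hchar
  have hstat := eval_affinePoint_of_stationary hq hqne hz
  set w := affinePoint z with hw
  set l := eval w (conj T (lotkaVolterra L) 0)
  have hTu : T.mulVec (T⁻¹.mulVec w) = w := by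
    rw [Matrix.mulVec_mulVec, Matrix.mul_nonsing_inv T hdet, Matrix.one_mulVec]
  have hu : T⁻¹.mulVec w ≠ 0 := by
    intro h
    rw [h, Matrix.mulVec_zero] at hTu
    exact affinePoint_ne_zero z hTu.symm
  have hul : ∀ i, eval (T⁻¹.mulVec w) (lotkaVolterra L i) = l * T⁻¹.mulVec w i := by
    have h := congrArg T⁻¹.mulVec (eval_conj T (lotkaVolterra L) w)
    rw [Matrix.mulVec_mulVec, Matrix.nonsing_inv_mul T hdet, Matrix.one_mulVec] at h
    rw [show (fun i => eval w (conj T (lotkaVolterra L) i)) = l • w from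
      _root_.funext hstat, Matrix.mulVec_smul] at h
    exact fun i => (congrFun h i).symm
  obtain ⟨μ, ν, hM, hli⟩ := exists_charpoly_jacobian_lotkaVolterra hdiag hL hu hul
  refine ⟨![μ, ν, -l], ?_, .inl hli⟩
  have hfactor : (jacobian (poincare (conj T (lotkaVolterra L))) z).charpoly =
      (Polynomial.X - Polynomial.C μ) * (Polynomial.X - Polynomial.C ν) *
        (Polynomial.X - Polynomial.C (-l)) := by
    -- The cancelled factor is the eigenvalue `2l` of the radial direction, shifted by `-l`.
    apply mul_right_cancel₀ (Polynomial.X_sub_C_ne_zero l)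
    rw [hchar, hM]
    simp
    ring
  rw [hfactor, Polynomial.roots_mul, Polynomial.roots_mul, Polynomial.roots_X_sub_C,
    Polynomial.roots_X_sub_C, Polynomial.roots_X_sub_C]
  · simp
    rfl
  all_goals simp only [ne_eq, mul_eq_zero, Polynomial.X_sub_C_ne_zero, or_self, not_false_eq_true]

/-! ### Distinguished fields with the given zero pattern -/

/-- Euler's identity applied twice; second partial derivatives of a quadratic form are constants. -/
theorem exists_eq_sum_of_isHomogeneous_two {n : ℕ} {q : MvPolynomial (Fin n) ℂ}
    (hq : q.IsHomogeneous 2) :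
    ∃ c : Fin n → Fin n → ℂ, q = ∑ i, ∑ j, C (c i j) * (X i * X j) := by
  have hc : ∀ i j, ∃ c, pderiv j (pderiv i q) = C c := fun i j =>
    ⟨_, totalDegree_eq_zero_iff_eq_C.mp
      (Nat.le_zero.mp (hq.pderiv (i := i)).pderiv.totalDegree_le)⟩
  choose c hc using hc
  refine ⟨fun i j => c i j / 2, ?_⟩
  have h₁ := hq.sum_X_mul_pderiv
  have h₂ : ∀ i, ∑ j, X j * C (c i j) = pderiv i q := fun i => by
    simpa [hc] using (hq.pderiv (i := i)).sum_X_mul_pderiv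
  have h2 : (C 2 : MvPolynomial (Fin n) ℂ) ≠ 0 := by simp
  apply mul_left_cancel₀ h2
  rw [show (C 2 : MvPolynomial (Fin n) ℂ) * q = 2 • q by
    rw [map_ofNat C 2, two_mul, two_smul], ← h₁,
    Finset.mul_sum]
  refine Finset.sum_congr rfl fun i _ => ?_
  rw [← h₂, Finset.mul_sum, Finset.mul_sum]
  refine Finset.sum_congr rfl fun j _ => ?_
  rw [← mul_assoc (C 2), ← C_mul, mul_div_cancel₀ _ (two_ne_zero' ℂ)]
  ring

/-- The interaction matrix of the Lotka–Volterra field that is distinguished with parameters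
`γ`. -/
noncomputable def interactionMatrix (γ : Matrix (Fin 3) (Fin 3) ℂ) : Matrix (Fin 3) (Fin 3) ℂ :=
  !![1, (1 - γ 0 0) / γ 0 1, (1 - γ 2 0) / γ 2 2;
    (1 - γ 0 1) / γ 0 0, 1, (1 - γ 1 1) / γ 1 2;
    (1 - γ 2 2) / γ 2 0, (1 - γ 1 2) / γ 1 1, 1]

/-- With `s = (1 - a) / b` and `t = (1 - b) / a`, solving the linear system gives `a = (1 - s) / (1
- s t)`; `hab` keeps the denominator nonzero. -/
theorem mem_of_div_mem {K : IntermediateField ℚ ℂ} {a b : ℂ} (ha : a ≠ 0) (hb : b ≠ 0)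
    (hab : a + b - 1 ≠ 0) (h₁ : (1 - a) / b ∈ K) (h₂ : (1 - b) / a ∈ K) : a ∈ K := by
  have h : a = (1 - (1 - a) / b) / (1 - (1 - a) / b * ((1 - b) / a)) := by
    have h₃ : 1 - (1 - a) / b * ((1 - b) / a) = (a + b - 1) / (a * b) := by
      field_simp
      ring
    rw [h₃]
    field_simp
    ring
  rw [h]
  exact K.div_mem (K.sub_mem K.one_mem h₁) (K.sub_mem K.one_mem (K.mul_mem h₁ h₂))

theorem algebraicIndependent_interactionMatrix {γ : Matrix (Fin 3) (Fin 3) ℂ}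
    (hγ : AlgebraicIndependent ℚ ![γ 0 0, γ 0 1, γ 1 1, γ 1 2, γ 2 0, γ 2 2]) :
    AlgebraicIndependent ℚ ![interactionMatrix γ 0 1, interactionMatrix γ 1 0,
      interactionMatrix γ 1 2, interactionMatrix γ 2 1, interactionMatrix γ 2 0,
      interactionMatrix γ 0 2] := by
  refine algebraicIndependent_of_mem_adjoin hγ ?_
  have hne := hγ.ne_zero
  have hsum : ∀ i j, ![γ 0 0, γ 0 1, γ 1 1, γ 1 2, γ 2 0, γ 2 2] i +
      ![γ 0 0, γ 0 1, γ 1 1, γ 1 2, γ 2 0, γ 2 2] j - 1 ≠ 0 := by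
    intro i j h
    have := eval_eq_zero_of_algebraicIndependent hγ (P := X i + X j - 1) (by simpa using h) 0
    simp at this
  have hmem := fun i => IntermediateField.subset_adjoin ℚ
    (Set.range ![interactionMatrix γ 0 1, interactionMatrix γ 1 0,
      interactionMatrix γ 1 2, interactionMatrix γ 2 1, interactionMatrix γ 2 0,
      interactionMatrix γ 0 2]) ⟨i, rfl⟩
  intro i
  fin_cases i
  · exact mem_of_div_mem (hne 0) (hne 1) (hsum 0 1) (hmem 0) (hmem 1)
  · exact mem_of_div_mem (hne 1) (hne 0) (hsum 1 0) (hmem 1) (hmem 0)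
  · exact mem_of_div_mem (hne 2) (hne 3) (hsum 2 3) (hmem 2) (hmem 3)
  · exact mem_of_div_mem (hne 3) (hne 2) (hsum 3 2) (hmem 3) (hmem 2)
  · exact mem_of_div_mem (hne 4) (hne 5) (hsum 4 5) (hmem 5) (hmem 4)
  · exact mem_of_div_mem (hne 5) (hne 4) (hsum 5 4) (hmem 4) (hmem 5)

theorem isDistinguished_lotkaVolterra {γ : Matrix (Fin 3) (Fin 3) ℂ}
    (h₀₂ : γ 0 2 = 0) (h₁₀ : γ 1 0 = 0) (h₂₁ : γ 2 1 = 0)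
    (h₀₀ : γ 0 0 ≠ 0) (h₀₁ : γ 0 1 ≠ 0) (h₁₁ : γ 1 1 ≠ 0) (h₁₂ : γ 1 2 ≠ 0) (h₂₀ : γ 2 0 ≠ 0)
    (h₂₂ : γ 2 2 ≠ 0) :
    IsDistinguished γ (lotkaVolterra (interactionMatrix γ)) where
  homogeneous := lotkaVolterra_isHomogeneous _
  basis_idempotent i := by
    refine ⟨by simp, fun k => ?_⟩
    rw [eval_lotkaVolterra]
    fin_cases i <;> fin_cases k <;> simp [interactionMatrix]
  row_idempotent i := by
    refine ⟨fun h => ?_, fun k => ?_⟩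
    · fin_cases i
      · exact h₀₀ (congrFun h 0)
      · exact h₁₁ (congrFun h 1)
      · exact h₂₂ (congrFun h 2)
    · rw [eval_lotkaVolterra]
      fin_cases i <;> fin_cases k <;>
        simp [interactionMatrix, h₀₂, h₁₀, h₂₁] <;> field_simp <;> ring
  isUnit_productMatrix := by
    rw [Matrix.isUnit_iff_isUnit_det, Matrix.det_fin_three]
    simp [productMatrix, h₀₂, h₁₀, h₂₁, h₀₀, h₀₁, h₁₁, h₁₂, h₂₀, h₂₂]

/-- The basis idempotents fix the square coefficients. Each row of `γ` is supported on two
coordinates, so it fixes exactly one mixed coefficient. -/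
theorem eq_lotkaVolterra_of_isDistinguished {γ : Matrix (Fin 3) (Fin 3) ℂ}
    (h₀₂ : γ 0 2 = 0) (h₁₀ : γ 1 0 = 0) (h₂₁ : γ 2 1 = 0)
    (h₀₀ : γ 0 0 ≠ 0) (h₀₁ : γ 0 1 ≠ 0) (h₁₁ : γ 1 1 ≠ 0) (h₁₂ : γ 1 2 ≠ 0) (h₂₀ : γ 2 0 ≠ 0)
    (h₂₂ : γ 2 2 ≠ 0) {p : VectorField 3} (hp : IsDistinguished γ p) :
    p = lotkaVolterra (interactionMatrix γ) := by
  ext1 k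
  obtain ⟨c, hc⟩ := exists_eq_sum_of_isHomogeneous_two (hp.homogeneous k)
  have hb := fun i => (hp.basis_idempotent i).2 k
  have hr := fun i => (hp.row_idempotent i).2 k
  simp only [hc, Fin.sum_univ_three, map_add, map_mul, eval_C, eval_X] at hb hr
  have b0 := hb 0
  have b1 := hb 1
  have b2 := hb 2
  have r0 := hr 0
  have r1 := hr 1
  have r2 := hr 2
  simp at b0 b1 b2
  simp only [h₀₂, h₁₀, h₂₁, mul_zero, zero_mul, add_zero, zero_add, b0, b1, b2] at r0 r1 r2
  have s0 : c 0 1 + c 1 0 = (γ 0 k - Pi.single (M := fun _ => ℂ) 0 1 k * γ 0 0 ^ 2 -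
      Pi.single (M := fun _ => ℂ) 1 1 k * γ 0 1 ^ 2) / (γ 0 0 * γ 0 1) := by
    rw [eq_div_iff (mul_ne_zero h₀₀ h₀₁)]
    linear_combination r0
  have s1 : c 1 2 + c 2 1 = (γ 1 k - Pi.single (M := fun _ => ℂ) 1 1 k * γ 1 1 ^ 2 -
      Pi.single (M := fun _ => ℂ) 2 1 k * γ 1 2 ^ 2) / (γ 1 1 * γ 1 2) := by
    rw [eq_div_iff (mul_ne_zero h₁₁ h₁₂)]
    linear_combination r1
  have s2 : c 0 2 + c 2 0 = (γ 2 k - Pi.single (M := fun _ => ℂ) 0 1 k * γ 2 0 ^ 2 -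
      Pi.single (M := fun _ => ℂ) 2 1 k * γ 2 2 ^ 2) / (γ 2 0 * γ 2 2) := by
    rw [eq_div_iff (mul_ne_zero h₂₀ h₂₂)]
    linear_combination r2
  refine MvPolynomial.funext fun x => ?_
  have hx : eval x (p k) = Pi.single (M := fun _ => ℂ) 0 1 k * x 0 ^ 2 +
      Pi.single (M := fun _ => ℂ) 1 1 k * x 1 ^ 2 + Pi.single (M := fun _ => ℂ) 2 1 k * x 2 ^ 2 +
      (c 0 1 + c 1 0) * x 0 * x 1 + (c 1 2 + c 2 1) * x 1 * x 2 + (c 0 2 + c 2 0) * x 0 * x 2 := by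
    rw [hc]
    simp only [Fin.sum_univ_three, map_add, map_mul, eval_C, eval_X, b0, b1, b2]
    ring
  rw [hx, eval_lotkaVolterra, s0, s1, s2]
  fin_cases k <;> simp [interactionMatrix, h₀₂, h₁₀, h₂₁] <;> field_simp <;> ring

end PolyVF

theorem mainTheorem8 :
    (∀ γ : Matrix (Fin 3) (Fin 3) ℂ,
      γ 0 2 = 0 → γ 1 0 = 0 → γ 2 1 = 0 →
      AlgebraicIndependent ℚ ![γ 0 0, γ 0 1, γ 1 1, γ 1 2, γ 2 0, γ 2 2] →
        (∃! p : PolyVF.VectorField 3, PolyVF.IsDistinguished γ p) ∧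
        ∀ p : PolyVF.VectorField 3, PolyVF.IsDistinguished γ p →
          (∀ i : Fin 3, PolyVF.IsSemiInvariant p (MvPolynomial.X i)) ∧ PolyVF.PropertyE p) ∧
    (∃ p : PolyVF.VectorField 3,
      (∀ k, (p k).IsHomogeneous 2) ∧ PolyVF.PropertyE p ∧
        ∀ i : Fin 3, PolyVF.IsSemiInvariant p (MvPolynomial.X i)) := by
  have hdiag : ∀ (γ : Matrix (Fin 3) (Fin 3) ℂ) (i : Fin 3),
      PolyVF.interactionMatrix γ i i = 1 := by
    intro γ i
    fin_cases i <;> rfl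
  refine ⟨fun γ h₀₂ h₁₀ h₂₁ hγ => ?_, ?_⟩
  · have hne := hγ.ne_zero
    have heq := fun p => PolyVF.eq_lotkaVolterra_of_isDistinguished (p := p) h₀₂ h₁₀ h₂₁ (hne 0)
      (hne 1) (hne 2) (hne 3) (hne 4) (hne 5)
    refine ⟨⟨_, PolyVF.isDistinguished_lotkaVolterra h₀₂ h₁₀ h₂₁ (hne 0)
      (hne 1) (hne 2) (hne 3) (hne 4) (hne 5), fun p hp => heq p hp⟩, fun p hp => ?_⟩
    rw [heq p hp]
    exact ⟨PolyVF.isSemiInvariant_lotkaVolterra _, PolyVF.propertyE_lotkaVolterra (hdiag γ)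
      (PolyVF.algebraicIndependent_interactionMatrix hγ)⟩
  -- Existence needs no `γ`: any unit-diagonal `L` with algebraically independent off-diagonal
  -- entries works.
  · obtain ⟨x, hx⟩ := PolyVF.exists_algebraicIndependent_complex 6
    let L : Matrix (Fin 3) (Fin 3) ℂ := !![1, x 0, x 5; x 1, 1, x 2; x 4, x 3, 1]
    refine ⟨PolyVF.lotkaVolterra L, PolyVF.lotkaVolterra_isHomogeneous L,
      PolyVF.propertyE_lotkaVolterra (fun i => by fin_cases i <;> rfl) ?_,
      PolyVF.isSemiInvariant_lotkaVolterra L⟩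
    convert hx using 1
    ext i
    fin_cases i <;> rfl
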